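/- **Setting.** Let $(\Omega,\mathbf P)$ be a probability space, let the action set $\mathcal A$, the outcome space $\mathcal Y$ and the space $\Xi$ be (nonempty) standard Borel spaces, and let $R:\mathcal Y\to\mathbb R$ be a measurable reward function. For each time $t\in\{0,1,2,\dots\}\cup\{\infty\}$ let $Y_t=(Y_{t,a})_{a\in\mathcal A}$ be a vector of $\mathcal Y$-valued random outcomes, with $(\omega,a)\mapsto Y_{t,a}(\omega)$ measurable. There is a random variable $\theta$ such that, conditioned on $\theta$, the vectors $Y_0,Y_1,Y_2,\dots,Y_\infty$ are i.i.d. with law $\kappa_\theta$, where $\kappa$ is a Markov kernel. Let $\xi$ be a $\Xi$-valued random variable that is independent of $(\theta,(Y_t)_{t\in\mathbb N_0})$. An action process is a sequence of $\mathcal A$-valued random variables of the form $A_t=\pi_t(\mathcal F_t,\xi)$, $t\in\mathbb N_0$, where $\mathcal F_t=(A_0,Y_{0,A_0},\dots,A_{t-1},Y_{t-1,A_{t-1}})$ is the history and the $\pi_t$ are measurable functions. Write $R_{t,A_t}=R(Y_{t,A_t})$ and $\mathbf E_t[\cdot]=\mathbf E[\cdot\mid\mathcal F_t]$. Let $R^*=\sup_{a\in\mathcal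 A}\mathbf E[R(Y_{\infty,a})\mid\theta]$, where the conditional means are computed with $\kappa_\theta$. For a random action $\tilde A:\Omega\to\mathcal A$ let $\tilde R=R(Y_{\infty,\tilde A})$. Let $\mathbf I_t(\tilde A;Y_{t,A_t}\mid\xi)\in[0,\infty]$ be the conditional mutual information of $\tilde A$ and $Y_{t,A_t}$ given $\xi$, computed under the conditional law of $(\tilde A,Y_{t,A_t},\xi)$ given $\mathcal F_t$ (a random variable, as it depends on the realized history), and let $\mathbf H(\tilde A\mid\xi)\in[0,\infty]$ be the conditional Shannon entropy, i.e. the expectation of the entropy of the conditional law of $\tilde A$ given $\xi$ (the entropy of a non-discrete law being $\infty$). For a discount factor $\alpha\in[0,1)$ define the discounted information ratio $$\Gamma\bigl(\tilde A,\{A_t\}\bigr)=(1-\alpha^2)\sum_{t=0}^\infty\alpha^{2t}\,\mathbf E\left[\frac{\bigl(\mathbf E_t[\tilde R-R_{t,A_t}]\bigr)^2}{\mathbf I_t(\tilde A;Y_{t,A_t}\mid\xi)}\right]\in[0,\infty],$$ with the conventions $0/0=0$, $c/0=\infty$ for $c>0$, $c/\infty=0$, and $0\cdot\infty=0$ for the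 products $\alpha^{2t}\cdot\mathbf E[\cdot]$. **Theorem.** Let $\alpha\in[0,1)$, let $\{A_t:t\in\mathbb N_0\}$ be an action process and let $\tilde A:\Omega\to\mathcal A$ be a random action. Suppose that almost surely the means $\mathbf E[R(Y_{\infty,a})\mid\theta]$, $a\in\mathcal A$, exist and are bounded above in $a$, that $R^*$, $\tilde R$ and every $R_{t,A_t}$ are integrable, and that $\sum_{t}\alpha^t\,\mathbf E|R_{t,A_t}|<\infty$ (all this holds, for instance, if $R$ is bounded and $R^*$ is measurable). Suppose also that the product $\Gamma(\tilde A,\{A_t\})\cdot\mathbf H(\tilde A\mid\xi)$ is not of the undefined form $0\cdot\infty$ or $\infty\cdot 0$. Then $$\mathbf E\left[\sum_{t=0}^\infty\alpha^t\,(R^*-R_{t,A_t})\right]\le\frac{\mathbf E[R^*-\tilde R]}{1-\alpha}+\sqrt{\frac{\Gamma\bigl(\tilde A,\{A_t\}\bigr)\,\mathbf H(\tilde A\mid\xi)}{1-\alpha^2}},$$ where the right-hand side may be $+\infty$. -/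

import Mathlib

open MeasureTheory ProbabilityTheory InformationTheory
open scoped ENNReal

/-- Shannon entropy (in nats) of a probability measure: the expectation of `-log μ{x}`.
It is `∑ x, -μ{x} log μ{x}` for a discrete `μ` and `∞` for a measure that is not discrete. -/
noncomputable def shannonEntropy {E : Type*} [MeasurableSpace E] (μ : Measure E) : ℝ≥0∞ :=
  ∫⁻ x, (-ENNReal.log (μ {x})).toENNReal ∂μ

/-- On a countable space the entropy is the usual sum `-∑ x, μ{x} log μ{x}`. -/
theorem shannonEntropy_eq_tsum {E : Type*} [MeasurableSpace E] [Countable E]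
    [MeasurableSingletonClass E] (μ : Measure E) [IsProbabilityMeasure μ] :
    shannonEntropy μ = ∑' x, ENNReal.ofReal (Real.negMulLog (μ.real {x})) := by
  rw [shannonEntropy, lintegral_countable']
  refine tsum_congr fun x => ?_
  rcases eq_or_ne (μ {x}) 0 with h | h
  · simp [h, measureReal_def]
  · have hlog : ENNReal.log (μ {x}) = ((Real.log (μ.real {x}) : ℝ) : EReal) :=
      ENNReal.log_pos_real h (measure_ne_top μ _)
    have hle : (0 : ℝ) ≤ -Real.log (μ.real {x}) := by
      have := Real.log_nonpos (measureReal_nonneg (μ := μ) (s := {x})) measureReal_le_one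
      linarith
    have hneg : Real.negMulLog (μ.real {x}) = -Real.log (μ.real {x}) * μ.real {x} := by
      rw [Real.negMulLog]; ring
    rw [hlog, hneg, ENNReal.ofReal_mul hle, ← EReal.coe_neg, EReal.toENNReal_of_ne_top (by simp)]
    simp

/-- Conditional entropy `H(X | Z)`: the expected entropy of the conditional law of `X` given `Z`. -/
noncomputable def condEntropy {Ω E G : Type*} [MeasurableSpace Ω]
    [MeasurableSpace E] [StandardBorelSpace E] [Nonempty E] [MeasurableSpace G]
    (X : Ω → E) (Z : Ω → G) (μ : Measure Ω) [IsFiniteMeasure μ] : ℝ≥0∞ :=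
  ∫⁻ ω, shannonEntropy (condDistrib X Z μ (Z ω)) ∂μ

/-- Conditional mutual information `I(X ; Y | Z)` under `μ`: the Kullback-Leibler divergence of
`P_Z ⊗ P_{(X,Y)|Z}` from `P_Z ⊗ (P_{X|Z} × P_{Y|Z})`. -/
noncomputable def condMutualInfo {Ω E F G : Type*} [MeasurableSpace Ω]
    [MeasurableSpace E] [StandardBorelSpace E] [Nonempty E]
    [MeasurableSpace F] [StandardBorelSpace F] [Nonempty F] [MeasurableSpace G]
    (X : Ω → E) (Y : Ω → F) (Z : Ω → G) (μ : Measure Ω) [IsFiniteMeasure μ] : ℝ≥0∞ :=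
  klDiv ((μ.map Z).compProd (condDistrib (fun ω => (X ω, Y ω)) Z μ))
    ((μ.map Z).compProd ((condDistrib X Z μ).prod (condDistrib Y Z μ)))

/-- The sequential decision problem on a probability space `(Ω, P)`: a parameter `θ`, outcomes
`Y t ω a` of the actions `a` at the times `t = 0, 1, 2, …` and `t = ⊤` (the latter is the
independent copy `Y_∞`), a reward function `R`, and the exogenous randomisation `ξ`. -/
structure BanditModel (Ω Θ Ξ 𝒜 𝒴 : Type*) [MeasurableSpace Ω] [MeasurableSpace Θ]
    [MeasurableSpace Ξ] [MeasurableSpace 𝒜] [MeasurableSpace 𝒴] (P : Measure Ω) where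
  θ : Ω → Θ
  measurable_θ : Measurable θ
  ξ : Ω → Ξ
  measurable_ξ : Measurable ξ
  Y : ℕ∞ → Ω → 𝒜 → 𝒴
  measurable_Y : ∀ t, Measurable fun p : Ω × 𝒜 => Y t p.1 p.2
  R : 𝒴 → ℝ
  measurable_R : Measurable R
  /-- `κ ϑ` is the law of an outcome vector `(Y_{t,a})_a` given `θ = ϑ`. -/
  κ : Kernel Θ (𝒜 → 𝒴)
  isMarkov_κ : IsMarkovKernel κ
  /-- Conditioned on `θ`, the outcome vectors `Y t`, `t ∈ {0, 1, 2, …, ⊤}`, are i.i.d. with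
  law `κ θ`. -/
  cond_iid : ∀ (C : Set Θ) (s : Finset ℕ∞) (B : ℕ∞ → Set (𝒜 → 𝒴)),
    MeasurableSet C → (∀ i, MeasurableSet (B i)) →
      P {ω | θ ω ∈ C ∧ ∀ i ∈ s, Y i ω ∈ B i} =
        ∫⁻ ω in θ ⁻¹' C, ∏ i ∈ s, κ (θ ω) (B i) ∂P
  indep_ξ : IndepFun ξ (fun ω => (θ ω, fun t : ℕ => Y t ω)) P

namespace BanditModel

variable {Ω Θ Ξ 𝒜 𝒴 : Type*} [MeasurableSpace Ω] [MeasurableSpace Θ]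
  [MeasurableSpace Ξ] [MeasurableSpace 𝒜] [MeasurableSpace 𝒴] {P : Measure Ω}

/-- `E[R(Y_{∞,a}) | θ = ϑ]`. -/
noncomputable def meanReward (M : BanditModel Ω Θ Ξ 𝒜 𝒴 P) (ϑ : Θ) (a : 𝒜) : ℝ :=
  ∫ y, M.R (y a) ∂(M.κ ϑ)

/-- The optimal reward `R* = sup_a E[R(Y_{∞,a}) | θ]`. -/
noncomputable def optReward (M : BanditModel Ω Θ Ξ 𝒜 𝒴 P) (ω : Ω) : ℝ :=
  ⨆ a, M.meanReward (M.θ ω) a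

/-- The observation `Y_{t,A_t}`. -/
def obs (M : BanditModel Ω Θ Ξ 𝒜 𝒴 P) (A : ℕ → Ω → 𝒜) (t : ℕ) (ω : Ω) : 𝒴 :=
  M.Y t ω (A t ω)

/-- The reward `R_{t,A_t}`. -/
def reward (M : BanditModel Ω Θ Ξ 𝒜 𝒴 P) (A : ℕ → Ω → 𝒜) (t : ℕ) (ω : Ω) : ℝ :=
  M.R (M.obs A t ω)

/-- The reward `R(Y_{∞,Ã})` of a benchmark action. -/
def benchReward (M : BanditModel Ω Θ Ξ 𝒜 𝒴 P) (Ab : Ω → 𝒜) (ω : Ω) : ℝ :=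
  M.R (M.Y ⊤ ω (Ab ω))

/-- The history `(A_0, Y_{0,A_0}, …, A_{t-1}, Y_{t-1,A_{t-1}})` available at time `t`. -/
def history (M : BanditModel Ω Θ Ξ 𝒜 𝒴 P) (A : ℕ → Ω → 𝒜) (t : ℕ) (ω : Ω) : Fin t → 𝒜 × 𝒴 :=
  fun i => (A i ω, M.obs A i ω)

/-- `A` is generated by a policy: `A_t = π_t(history, ξ)`. -/
def IsPolicyDriven (M : BanditModel Ω Θ Ξ 𝒜 𝒴 P) (A : ℕ → Ω → 𝒜) : Prop :=
  ∃ π : (t : ℕ) → (Fin t → 𝒜 × 𝒴) × Ξ → 𝒜,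
    (∀ t, Measurable (π t)) ∧ ∀ t ω, A t ω = π t (M.history A t ω, M.ξ ω)

/-- `E_t[R̃ - R_{t,A_t}]`, the conditional expectation given the history at time `t`. -/
noncomputable def shortfall (M : BanditModel Ω Θ Ξ 𝒜 𝒴 P) (A : ℕ → Ω → 𝒜) (Ab : Ω → 𝒜) (t : ℕ) :
    Ω → ℝ :=
  P[fun ω => M.benchReward Ab ω - M.reward A t ω |
    MeasurableSpace.comap (M.history A t) inferInstance]

section Information

variable [StandardBorelSpace 𝒜] [Nonempty 𝒜] [StandardBorelSpace 𝒴] [Nonempty 𝒴]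
  [StandardBorelSpace Ξ] [Nonempty Ξ] [IsProbabilityMeasure P]

/-- The random variable `I_t(Ã ; Y_{t,A_t} | ξ)`: the conditional mutual information computed
under the posterior law of `(Ã, Y_{t,A_t}, ξ)` given the history at time `t`. -/
noncomputable def infoGain (M : BanditModel Ω Θ Ξ 𝒜 𝒴 P) (A : ℕ → Ω → 𝒜) (Ab : Ω → 𝒜) (t : ℕ)
    (ω : Ω) : ℝ≥0∞ :=
  condMutualInfo (fun p : 𝒜 × 𝒴 × Ξ => p.1) (fun p => p.2.1) (fun p => p.2.2)
    (condDistrib (fun ω' => (Ab ω', M.obs A t ω', M.ξ ω')) (M.history A t) P (M.history A t ω))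

/-- The discounted information ratio `Γ(Ã, {A_t})`, with values in `[0, ∞]`. Division is that
of `[0, ∞]`: `0 / 0 = 0` and `c / 0 = ∞` for `c > 0`. -/
noncomputable def infoRatio (M : BanditModel Ω Θ Ξ 𝒜 𝒴 P) (α : ℝ) (A : ℕ → Ω → 𝒜)
    (Ab : Ω → 𝒜) : ℝ≥0∞ :=
  ENNReal.ofReal (1 - α ^ 2) * ∑' t : ℕ, ENNReal.ofReal (α ^ (2 * t)) *
    ∫⁻ ω, ENNReal.ofReal (M.shortfall A Ab t ω ^ 2) / M.infoGain A Ab t ω ∂P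

end Information

end BanditModel

/-!
The conditional mutual information `I_t(Ã ; Y_{t,A_t} | ξ)` is the mean Kullback-Leibler divergence
of the law of `Ã` after observing `Y_{t,A_t}` from its law before the observation. By the cross
entropy identity `∫ -log ν{x} dμ = KL(μ, ν) + H(μ)` this divergence is the drop of the conditional
entropy of `Ã`, so the expected information gains telescope and sum up to at most `H(Ã | ξ)`.

The regret is `E[R* - R̃] / (1 - α)` plus the discounted sum of the expected shortfalls `E[s_t]`,
where `s_t = E_t[R̃ - R_{t,A_t}]`. Cauchy-Schwarz on `Ω` and then over time gives
`(∑ α^t E|s_t|)² / ∑ E[I_t] ≤ ∑ α^(2t) E[s_t² / I_t]`, whose right-hand side is `Γ / (1 - α²)`.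
-/

section Divergence

variable {D E F : Type*} [MeasurableSpace D] [MeasurableSpace E] [MeasurableSpace F]

theorem klDiv_withDensity {μ : Measure E} [IsFiniteMeasure μ] {f : E → ℝ≥0∞} (hf : Measurable f)
    [IsFiniteMeasure (μ.withDensity f)] :
    klDiv (μ.withDensity f) μ = ∫⁻ x, ENNReal.ofReal (klFun (f x).toReal) ∂μ := by
  rw [klDiv_eq_lintegral_klFun_of_ac (withDensity_absolutelyContinuous _ _)]
  refine lintegral_congr_ae ?_
  filter_upwards [Measure.rnDeriv_withDensity μ hf] with x hx
  rw [hx]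

theorem klDiv_map_measurableEquiv (e : E ≃ᵐ F) (μ ν : Measure E) [IsFiniteMeasure μ]
    [IsFiniteMeasure ν] : klDiv (μ.map e) (ν.map e) = klDiv μ ν := by
  refine le_antisymm (klDiv_map_le μ ν e.measurable) ?_
  simpa only [MeasurableEquiv.map_symm_map] using
    klDiv_map_le (μ.map e) (ν.map e) e.symm.measurable

section Kernel

variable [MeasurableSpace.CountableOrCountablyGenerated D E] (κ η : Kernel D E)

theorem measurable_klFun_rnDeriv :
    Measurable fun p : D × E => ENNReal.ofReal (klFun (κ.rnDeriv η p.1 p.2).toReal) :=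
  (measurable_klFun.comp (Kernel.measurable_rnDeriv κ η).ennreal_toReal).ennreal_ofReal

variable [IsFiniteKernel κ] [IsFiniteKernel η]

theorem klDiv_kernel_apply_eq_lintegral {a : D} (h : κ a ≪ η a) :
    klDiv (κ a) (η a) = ∫⁻ x, ENNReal.ofReal (klFun (κ.rnDeriv η a x).toReal) ∂η a := by
  rw [klDiv_eq_lintegral_klFun_of_ac h]
  refine lintegral_congr_ae ?_
  filter_upwards [Kernel.rnDeriv_eq_rnDeriv_measure (κ := κ) (η := η) (a := a)] with x hx
  rw [hx]

theorem measurable_klDiv_kernel : Measurable fun a => klDiv (κ a) (η a) := by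
  classical
  have h : (fun a => klDiv (κ a) (η a)) = fun a => if κ a ≪ η a then
      ∫⁻ x, ENNReal.ofReal (klFun (κ.rnDeriv η a x).toReal) ∂η a else ∞ := by
    funext a
    split_ifs with ha
    exacts [klDiv_kernel_apply_eq_lintegral κ η ha, klDiv_of_not_ac ha]
  rw [h]
  exact (measurable_klFun_rnDeriv κ η).lintegral_kernel_prod_right'.ite
    (Kernel.measurableSet_absolutelyContinuous κ η) measurable_const

theorem klDiv_compProd_right (μ : Measure D) [IsFiniteMeasure μ] :
    klDiv (μ ⊗ₘ κ) (μ ⊗ₘ η) = ∫⁻ a, klDiv (κ a) (η a) ∂μ := by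
  by_cases hac : ∀ᵐ a ∂μ, κ a ≪ η a
  · have hκ : ∀ᵐ a ∂μ, κ a = η.withDensity (κ.rnDeriv η) a := by
      filter_upwards [hac] with a ha using (Kernel.withDensity_rnDeriv_eq ha).symm
    have hdens : μ ⊗ₘ κ = (μ ⊗ₘ η).withDensity fun p => κ.rnDeriv η p.1 p.2 := by
      rw [Measure.compProd_congr hκ, Measure.compProd_withDensity (Kernel.measurable_rnDeriv κ η)]
    have : IsFiniteMeasure ((μ ⊗ₘ η).withDensity fun p => κ.rnDeriv η p.1 p.2) :=
      hdens ▸ inferInstance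
    rw [hdens, klDiv_withDensity (Kernel.measurable_rnDeriv κ η),
      Measure.lintegral_compProd (measurable_klFun_rnDeriv κ η)]
    refine lintegral_congr_ae ?_
    filter_upwards [hac] with a ha using (klDiv_kernel_apply_eq_lintegral κ η ha).symm
  · rw [klDiv_of_not_ac (mt Measure.absolutelyContinuous_compProd_right_iff.1 hac)]
    by_contra hne
    refine hac ?_
    filter_upwards [ae_lt_top (measurable_klDiv_kernel κ η) (Ne.symm hne)] with a ha
    exact of_not_not fun h => ha.ne (klDiv_of_not_ac h)

end Kernel

end Divergence

section Surprisal

variable {D E : Type*} [MeasurableSpace D] [MeasurableSpace E]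

/-- The surprisal `-log μ{x}` of the point `x`, equal to `∞` when `x` is not an atom of `μ`. Its
`μ`-mean is the entropy of `μ`, its mean under another measure is a cross entropy. -/
noncomputable def surprisal (μ : Measure E) (x : E) : ℝ≥0∞ :=
  (-ENNReal.log (μ {x})).toENNReal

theorem surprisal_eq_top_iff {μ : Measure E} {x : E} : surprisal μ x = ∞ ↔ μ {x} = 0 := by
  rw [surprisal, EReal.toENNReal_eq_top_iff, EReal.neg_eq_top_iff, ENNReal.log_eq_bot_iff]

theorem surprisal_eq_ofReal {μ : Measure E} [IsProbabilityMeasure μ] {x : E} (hx : μ {x} ≠ 0) :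
    surprisal μ x = ENNReal.ofReal (-Real.log (μ.real {x})) := by
  rw [surprisal, ENNReal.log_pos_real hx (measure_ne_top μ _), ← EReal.coe_neg, measureReal_def,
    EReal.toENNReal_of_ne_top (EReal.coe_ne_top _), EReal.toReal_coe]

theorem neg_log_measureReal_nonneg {μ : Measure E} [IsProbabilityMeasure μ] (s : Set E) :
    0 ≤ -Real.log (μ.real s) :=
  neg_nonneg.2 (Real.log_nonpos measureReal_nonneg measureReal_le_one)

theorem measurable_kernel_apply_singleton [MeasurableEq E] (κ : Kernel D E) [IsSFiniteKernel κ] :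
    Measurable fun p : D × E => κ p.1 {p.2} := by
  have hs : MeasurableSet {q : (D × E) × E | q.2 = q.1.2} :=
    measurableSet_eq_fun measurable_snd (measurable_snd.comp measurable_fst)
  exact Kernel.measurable_kernel_prodMk_left (κ := Kernel.prodMkRight E κ) hs

theorem measurable_surprisal_kernel [MeasurableEq E] (κ : Kernel D E) [IsSFiniteKernel κ] :
    Measurable fun p : D × E => surprisal (κ p.1) p.2 :=
  (ENNReal.measurable_log.comp (measurable_kernel_apply_singleton κ)).neg.ereal_toENNReal

theorem eq_withDensity_of_ae_singleton_ne_zero [MeasurableSingletonClass E] {μ ν : Measure E}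
    [IsFiniteMeasure ν] (h : ∀ᵐ x ∂μ, ν {x} ≠ 0) :
    μ = ν.withDensity fun x => μ {x} / ν {x} := by
  set S : Set E := {x | ν {x} ≠ 0}
  have hS : S.Countable := Measure.countable_meas_pos_of_disjoint_iUnion
    (fun x => measurableSet_singleton x) (fun x y hxy => by simpa using hxy) |>.mono
      fun x hx => pos_iff_ne_zero.2 hx
  have hμS : μ Sᶜ = 0 := h
  have hdensS : (ν.withDensity fun x => μ {x} / ν {x}) Sᶜ = 0 := by
    rw [withDensity_apply _ hS.measurableSet.compl]
    refine setLIntegral_eq_zero hS.measurableSet.compl fun x hx => ?_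
    have hx0 : μ {x} = 0 := measure_mono_null (Set.singleton_subset_iff.2 hx) hμS
    simp only [hx0, ENNReal.zero_div, Pi.zero_apply]
  refine Measure.ext fun B _ => ?_
  rw [← measure_inter_conull (s := B) hμS, ← measure_inter_conull (s := B) hdensS]
  have hBS : (B ∩ S).Countable := hS.mono Set.inter_subset_right
  have hsum (ρ : Measure E) : ρ (B ∩ S) = ∑' x : ↥(B ∩ S), ρ {(x : E)} := by
    rw [← measure_biUnion hBS (fun x _ y _ hxy => Set.disjoint_singleton.2 hxy)
      (fun x _ => measurableSet_singleton x), Set.biUnion_of_singleton]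
  rw [hsum, hsum]
  refine tsum_congr fun x => ?_
  rw [withDensity_apply _ (measurableSet_singleton _), lintegral_singleton,
    ENNReal.div_mul_cancel x.2.2 (measure_ne_top _ _)]

/-- The pointwise form of the decomposition of the cross entropy: with `r = μ{x} / ν{x}`, it reads
`-r log ν{x} + 1 = (r log r + 1 - r) + r - r log μ{x}`, where `1` is added to both sides so that no
subtraction occurs in `ℝ≥0∞`. -/
theorem div_mul_surprisal_add_one (μ ν : Measure E) [IsProbabilityMeasure μ]
    [IsProbabilityMeasure ν] (x : E) :
    μ {x} / ν {x} * surprisal ν x + 1 =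
      ENNReal.ofReal (klFun (μ {x} / ν {x}).toReal) + μ {x} / ν {x} +
        μ {x} / ν {x} * surprisal μ x := by
  rcases eq_or_ne (μ {x}) 0 with hμ | hμ
  · simp [hμ, klFun_zero]
  rcases eq_or_ne (ν {x}) 0 with hν | hν
  · simp [hν, ENNReal.div_zero hμ, surprisal_eq_top_iff.2 hν]
  have hν0 : 0 < ν.real {x} := ENNReal.toReal_pos hν (measure_ne_top _ _)
  have hμ0 : 0 < μ.real {x} := ENNReal.toReal_pos hμ (measure_ne_top _ _)
  have hr : μ {x} / ν {x} = ENNReal.ofReal (μ.real {x} / ν.real {x}) := by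
    rw [ENNReal.ofReal_div_of_pos hν0, ofReal_measureReal, ofReal_measureReal]
  have hr0 : 0 ≤ μ.real {x} / ν.real {x} := by positivity
  have hlogμ := neg_log_measureReal_nonneg (μ := μ) {x}
  have hlogν := neg_log_measureReal_nonneg (μ := ν) {x}
  have hkl := klFun_nonneg hr0
  rw [surprisal_eq_ofReal hν, surprisal_eq_ofReal hμ, hr, ENNReal.toReal_ofReal hr0,
    ← ENNReal.ofReal_mul hr0, ← ENNReal.ofReal_mul hr0, ← ENNReal.ofReal_one,
    ← ENNReal.ofReal_add (by positivity) zero_le_one, ← ENNReal.ofReal_add hkl hr0,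
    ← ENNReal.ofReal_add (by positivity) (by positivity), klFun_apply,
    Real.log_div hμ0.ne' hν0.ne']
  congr 1
  ring

variable [MeasurableEq E]

theorem measurable_surprisal (μ : Measure E) [SFinite μ] : Measurable (surprisal μ) :=
  (measurable_surprisal_kernel (Kernel.const Unit μ)).comp (measurable_prodMk_left (x := ()))

theorem lintegral_surprisal_of_ae_singleton_ne_zero {μ ν : Measure E} [IsProbabilityMeasure μ]
    [IsProbabilityMeasure ν] (h : ∀ᵐ x ∂μ, ν {x} ≠ 0) :
    ∫⁻ x, surprisal ν x ∂μ = klDiv μ ν + shannonEntropy μ := by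
  set f : E → ℝ≥0∞ := fun x => μ {x} / ν {x}
  have hf : Measurable f :=
    ((measurable_kernel_apply_singleton (Kernel.const Unit μ)).div
      (measurable_kernel_apply_singleton (Kernel.const Unit ν))).comp
        (measurable_prodMk_left (x := ()))
  have hdens : μ = ν.withDensity f := eq_withDensity_of_ae_singleton_ne_zero h
  have hchange {g : E → ℝ≥0∞} (hg : Measurable g) : ∫⁻ x, g x ∂μ = ∫⁻ x, f x * g x ∂ν := by
    conv_lhs => rw [hdens]
    exact lintegral_withDensity_eq_lintegral_mul _ hf hg
  have hf1 : ∫⁻ x, f x ∂ν = 1 := by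
    simpa using (hchange measurable_one).symm
  have : IsFiniteMeasure (ν.withDensity f) := hdens ▸ inferInstance
  have hkl : klDiv μ ν = ∫⁻ x, ENNReal.ofReal (klFun (f x).toReal) ∂ν := by
    conv_lhs => rw [hdens]
    exact klDiv_withDensity hf
  have hkl_meas : Measurable fun x => ENNReal.ofReal (klFun (f x).toReal) :=
    (measurable_klFun.comp hf.ennreal_toReal).ennreal_ofReal
  refine (ENNReal.add_left_inj ENNReal.one_ne_top).1 ?_
  calc ∫⁻ x, surprisal ν x ∂μ + 1
      = ∫⁻ x, (f x * surprisal ν x + 1) ∂ν := by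
        rw [hchange (measurable_surprisal ν), lintegral_add_right _ measurable_const]
        simp
    _ = ∫⁻ x, (ENNReal.ofReal (klFun (f x).toReal) + f x + f x * surprisal μ x) ∂ν :=
        lintegral_congr fun x => div_mul_surprisal_add_one μ ν x
    _ = klDiv μ ν + 1 + shannonEntropy μ := by
        rw [lintegral_add_left (by fun_prop), lintegral_add_left hkl_meas, ← hkl, hf1,
          ← hchange (measurable_surprisal μ)]
        rfl
    _ = klDiv μ ν + shannonEntropy μ + 1 := add_right_comm _ _ _

theorem lintegral_surprisal_eq_klDiv_add_shannonEntropy (μ ν : Measure E)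
    [IsProbabilityMeasure μ] [IsProbabilityMeasure ν] :
    ∫⁻ x, surprisal ν x ∂μ = klDiv μ ν + shannonEntropy μ := by
  by_cases h : ∀ᵐ x ∂μ, ν {x} ≠ 0
  · exact lintegral_surprisal_of_ae_singleton_ne_zero h
  have hcross : ∫⁻ x, surprisal ν x ∂μ = ∞ := by
    by_contra hne
    refine h ?_
    filter_upwards [ae_lt_top (measurable_surprisal ν) hne] with x hx
    exact fun h0 => hx.ne (surprisal_eq_top_iff.2 h0)
  by_cases hac : μ ≪ ν
  · have hent : shannonEntropy μ = ∞ := by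
      by_contra hne
      refine h ?_
      filter_upwards [ae_lt_top (measurable_surprisal μ) hne] with x hx
      exact fun h0 => hx.ne (surprisal_eq_top_iff.2 (hac h0))
    rw [hcross, hent, add_top]
  · rw [hcross, klDiv_of_not_ac hac, top_add]

end Surprisal

section CondDistrib

variable {Ω D E F G T : Type*} [MeasurableSpace Ω] [MeasurableSpace D]
  [MeasurableSpace E] [StandardBorelSpace E] [Nonempty E] [MeasurableSpace F]
  [MeasurableSpace G] [StandardBorelSpace G] [Nonempty G]
  [MeasurableSpace T] [StandardBorelSpace T] [Nonempty T]
  {P : Measure Ω} [IsFiniteMeasure P] {X : Ω → E} {V : Ω → D} {Z : Ω → G} {U : Ω → T}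

theorem lintegral_condDistrib (hX : Measurable X) (hV : Measurable V) {f : D → E → ℝ≥0∞}
    (hf : Measurable (Function.uncurry f)) :
    ∫⁻ ω, ∫⁻ x, f (V ω) x ∂condDistrib X V P (V ω) ∂P = ∫⁻ ω, f (V ω) (X ω) ∂P := by
  calc ∫⁻ ω, ∫⁻ x, f (V ω) x ∂condDistrib X V P (V ω) ∂P
      = ∫⁻ v, ∫⁻ x, f v x ∂condDistrib X V P v ∂P.map V :=
        (lintegral_map hf.lintegral_kernel_prod_right' hV).symm
    _ = ∫⁻ p, f p.1 p.2 ∂P.map fun ω => (V ω, X ω) := by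
        rw [← compProd_map_condDistrib hX.aemeasurable]
        exact (Measure.lintegral_compProd hf).symm
    _ = ∫⁻ ω, f (V ω) (X ω) ∂P := lintegral_map hf (hV.prodMk hX)

theorem condEntropy_eq_lintegral_surprisal (hX : Measurable X) (hV : Measurable V) :
    condEntropy X V P = ∫⁻ ω, surprisal (condDistrib X V P (V ω)) (X ω) ∂P :=
  lintegral_condDistrib (f := fun v => surprisal (condDistrib X V P v)) hX hV
    (measurable_surprisal_kernel (condDistrib X V P))

theorem condEntropy_comp_eq_lintegral_klDiv_add {g : D → F} (hX : Measurable X)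
    (hV : Measurable V) (hg : Measurable g) :
    condEntropy X (g ∘ V) P =
      ∫⁻ ω, klDiv (condDistrib X V P (V ω)) (condDistrib X (g ∘ V) P (g (V ω))) ∂P +
        condEntropy X V P := by
  have hsurp : Measurable (Function.uncurry fun v => surprisal (condDistrib X (g ∘ V) P (g v))) :=
    measurable_surprisal_kernel ((condDistrib X (g ∘ V) P).comap g hg)
  have hkl : Measurable fun v => klDiv (condDistrib X V P v) (condDistrib X (g ∘ V) P (g v)) :=
    measurable_klDiv_kernel _ ((condDistrib X (g ∘ V) P).comap g hg)
  calc condEntropy X (g ∘ V) P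
      = ∫⁻ ω, surprisal (condDistrib X (g ∘ V) P (g (V ω))) (X ω) ∂P :=
        condEntropy_eq_lintegral_surprisal hX (hg.comp hV)
    _ = ∫⁻ ω, ∫⁻ x, surprisal (condDistrib X (g ∘ V) P (g (V ω))) x
          ∂condDistrib X V P (V ω) ∂P :=
        (lintegral_condDistrib hX hV hsurp).symm
    _ = ∫⁻ ω, (klDiv (condDistrib X V P (V ω)) (condDistrib X (g ∘ V) P (g (V ω))) +
          shannonEntropy (condDistrib X V P (V ω))) ∂P := by
        simp only [lintegral_surprisal_eq_klDiv_add_shannonEntropy]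
    _ = _ := lintegral_add_left (hkl.comp hV) _

theorem condEntropy_le_condEntropy_comp {g : D → F} (hX : Measurable X) (hV : Measurable V)
    (hg : Measurable g) : condEntropy X V P ≤ condEntropy X (g ∘ V) P :=
  (condEntropy_comp_eq_lintegral_klDiv_add (P := P) hX hV hg).symm ▸ le_add_self

theorem condDistrib_prod_ae_eq_compProd (hV : Measurable V) (hZ : Measurable Z)
    (hX : Measurable X) :
    condDistrib (fun ω => (Z ω, X ω)) V P =ᵐ[P.map V]
      condDistrib Z V P ⊗ₖ condDistrib X (fun ω => (V ω, Z ω)) P := by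
  refine condDistrib_ae_eq_of_measure_eq_compProd _ (by fun_prop) ?_
  rw [← Measure.compProd_assoc', compProd_map_condDistrib hZ.aemeasurable,
    compProd_map_condDistrib hX.aemeasurable, Measure.map_map (by fun_prop) (by fun_prop)]
  rfl

theorem ae_condDistrib_condDistrib_ae_eq (hV : Measurable V) (hU : Measurable U) {x : T → E}
    {z : T → G} (hx : Measurable x) (hz : Measurable z) :
    ∀ᵐ v ∂P.map V, condDistrib x z (condDistrib U V P v) =ᵐ[(condDistrib U V P v).map z]
      (condDistrib (x ∘ U) (fun ω => (V ω, z (U ω))) P).sectR v := by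
  filter_upwards [condDistrib_comp (μ := P) V hU.aemeasurable hz,
    condDistrib_comp (μ := P) V hU.aemeasurable (hz.prodMk hx),
    condDistrib_prod_ae_eq_compProd (P := P) hV (hz.comp hU) (hx.comp hU)]
    with v hmap_z hmap_zx hprod
  refine condDistrib_ae_eq_of_measure_eq_compProd _ hx.aemeasurable ?_
  rw [Kernel.map_apply _ hz] at hmap_z
  rw [Kernel.map_apply _ (hz.prodMk hx)] at hmap_zx
  rw [← hmap_z, ← hmap_zx, ← Kernel.compProd_apply_eq_compProd_sectR]
  exact hprod

end CondDistrib

section CondMutualInfo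

variable {Ω D E F G T : Type*} [MeasurableSpace Ω] [MeasurableSpace D]
  [MeasurableSpace E] [MeasurableSpace F] [MeasurableSpace G] [MeasurableSpace T]

theorem map_compProd_prod (μ : Measure G) [SFinite μ] (κ : Kernel G E) [IsSFiniteKernel κ]
    (η : Kernel G F) [IsSFiniteKernel η] :
    (μ ⊗ₘ (κ ×ₖ η)).map (fun p => ((p.1, p.2.2), p.2.1)) = (μ ⊗ₘ η) ⊗ₘ κ.prodMkRight F := by
  refine Measure.ext_of_lintegral _ fun f hf => ?_
  have hf' : Measurable fun p : G × E × F => f ((p.1, p.2.2), p.2.1) := by fun_prop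
  rw [lintegral_map hf (by fun_prop), Measure.lintegral_compProd hf', Measure.lintegral_compProd hf,
    Measure.lintegral_compProd hf.lintegral_kernel_prod_right']
  exact lintegral_congr fun z => Kernel.lintegral_prod_symm _ _ _ (hf'.comp measurable_prodMk_left)

variable [StandardBorelSpace E] [Nonempty E] {P : Measure Ω} [IsFiniteMeasure P] {V : Ω → D}
  {U : Ω → T} {x : T → E} {y : T → F} {z : T → G}

theorem measurable_klDiv_condDistrib_condDistrib (hy : Measurable y) (hz : Measurable z) :
    Measurable (Function.uncurry fun v p =>
      klDiv (condDistrib (x ∘ U) (fun ω => (V ω, z (U ω), y (U ω))) P (v, z p, y p))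
        (condDistrib (x ∘ U) (fun ω => (V ω, z (U ω))) P (v, z p))) :=
  measurable_klDiv_kernel
    ((condDistrib (x ∘ U) (fun ω => (V ω, z (U ω), y (U ω))) P).comap
      (fun q : D × T => (q.1, z q.2, y q.2)) (by fun_prop))
    ((condDistrib (x ∘ U) (fun ω => (V ω, z (U ω))) P).comap
      (fun q : D × T => (q.1, z q.2)) (by fun_prop))

variable [StandardBorelSpace F] [Nonempty F]

theorem condMutualInfo_eq_lintegral_klDiv (ρ : Measure T) [IsFiniteMeasure ρ]
    (hx : Measurable x) (hy : Measurable y) (hz : Measurable z) :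
    condMutualInfo x y z ρ =
      ∫⁻ p, klDiv (condDistrib x (fun p => (z p, y p)) ρ (z p, y p)) (condDistrib x z ρ (z p))
        ∂ρ := by
  let e : G × E × F ≃ᵐ (G × F) × E :=
    ((MeasurableEquiv.refl G).prodCongr MeasurableEquiv.prodComm).trans
      MeasurableEquiv.prodAssoc.symm
  have hjoint : (ρ.map z ⊗ₘ condDistrib (fun p => (x p, y p)) z ρ).map e =
      ρ.map (fun p => (z p, y p)) ⊗ₘ condDistrib x (fun p => (z p, y p)) ρ := by
    rw [compProd_map_condDistrib (by fun_prop), compProd_map_condDistrib (by fun_prop),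
      Measure.map_map e.measurable (by fun_prop)]
    rfl
  have hindep : (ρ.map z ⊗ₘ (condDistrib x z ρ ×ₖ condDistrib y z ρ)).map e =
      ρ.map (fun p => (z p, y p)) ⊗ₘ (condDistrib x z ρ).prodMkRight F := by
    rw [← compProd_map_condDistrib hy.aemeasurable, ← map_compProd_prod]
    rfl
  rw [condMutualInfo, ← klDiv_map_measurableEquiv e, hjoint, hindep, klDiv_compProd_right,
    lintegral_map (measurable_klDiv_kernel _ _) (by fun_prop)]
  rfl

variable [StandardBorelSpace G] [Nonempty G] [StandardBorelSpace T] [Nonempty T]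

theorem ae_condMutualInfo_condDistrib (hV : Measurable V) (hU : Measurable U) (hx : Measurable x)
    (hy : Measurable y) (hz : Measurable z) :
    ∀ᵐ v ∂P.map V, condMutualInfo x y z (condDistrib U V P v) =
      ∫⁻ p, klDiv (condDistrib (x ∘ U) (fun ω => (V ω, z (U ω), y (U ω))) P (v, z p, y p))
        (condDistrib (x ∘ U) (fun ω => (V ω, z (U ω))) P (v, z p)) ∂condDistrib U V P v := by
  filter_upwards [ae_condDistrib_condDistrib_ae_eq (P := P) hV hU hx hz,
    ae_condDistrib_condDistrib_ae_eq (P := P) hV hU hx (hz.prodMk hy)] with v hprior hpost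
  rw [condMutualInfo_eq_lintegral_klDiv _ hx hy hz]
  refine lintegral_congr_ae ?_
  filter_upwards [ae_of_ae_map (by fun_prop) hprior, ae_of_ae_map (by fun_prop) hpost] with p h1 h2
  rw [h1, h2]
  rfl

theorem aemeasurable_condMutualInfo_condDistrib (hV : Measurable V) (hU : Measurable U)
    (hx : Measurable x) (hy : Measurable y) (hz : Measurable z) :
    AEMeasurable (fun ω => condMutualInfo x y z (condDistrib U V P (V ω))) P :=
  AEMeasurable.comp_measurable
    ⟨_, (measurable_klDiv_condDistrib_condDistrib hy hz).lintegral_kernel_prod_right',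
      ae_condMutualInfo_condDistrib hV hU hx hy hz⟩ hV

theorem condEntropy_eq_lintegral_condMutualInfo_add (hV : Measurable V) (hU : Measurable U)
    (hx : Measurable x) (hy : Measurable y) (hz : Measurable z) :
    condEntropy (x ∘ U) (fun ω => (V ω, z (U ω))) P =
      ∫⁻ ω, condMutualInfo x y z (condDistrib U V P (V ω)) ∂P +
        condEntropy (x ∘ U) (fun ω => (V ω, z (U ω), y (U ω))) P := by
  have hmutual : ∫⁻ ω, condMutualInfo x y z (condDistrib U V P (V ω)) ∂P =
      ∫⁻ ω, klDiv (condDistrib (x ∘ U) (fun ω => (V ω, z (U ω), y (U ω))) P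
          (V ω, z (U ω), y (U ω)))
        (condDistrib (x ∘ U) (fun ω => (V ω, z (U ω))) P (V ω, z (U ω))) ∂P := by
    rw [← lintegral_condDistrib (P := P) hU hV (measurable_klDiv_condDistrib_condDistrib hy hz)]
    exact lintegral_congr_ae
      (ae_of_ae_map hV.aemeasurable (ae_condMutualInfo_condDistrib hV hU hx hy hz))
  rw [hmutual]
  exact condEntropy_comp_eq_lintegral_klDiv_add (g := fun q : D × G × F => (q.1, q.2.1))
    (V := fun ω => (V ω, z (U ω), y (U ω))) (hx.comp hU) (by fun_prop) (by fun_prop)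

end CondMutualInfo

section CauchySchwarz

variable {Ω ι : Type*} [MeasurableSpace Ω] {μ : Measure Ω}

theorem sq_lintegral_le_lintegral_sq_div_mul {s w : Ω → ℝ≥0∞} (hs : AEMeasurable s μ)
    (hw : AEMeasurable w μ) (hdiv : ∫⁻ ω, s ω ^ 2 / w ω ∂μ ≠ ∞) (hwtop : ∫⁻ ω, w ω ∂μ ≠ ∞) :
    (∫⁻ ω, s ω ∂μ) ^ 2 ≤ (∫⁻ ω, s ω ^ 2 / w ω ∂μ) * ∫⁻ ω, w ω ∂μ := by
  have hd : AEMeasurable (fun ω => s ω ^ 2 / w ω) μ := (hs.pow_const 2).div hw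
  have hsq (x : ℝ≥0∞) : (x ^ (1 / 2 : ℝ)) ^ 2 = x := by
    rw [← ENNReal.rpow_natCast, ← ENNReal.rpow_mul]; norm_num
  have hfactor : ∀ᵐ ω ∂μ, s ω = (s ω ^ 2 / w ω) ^ (1 / 2 : ℝ) * w ω ^ (1 / 2 : ℝ) := by
    filter_upwards [ae_lt_top' hd hdiv, ae_lt_top' hw hwtop] with ω hdω hwω
    refine ((ENNReal.pow_right_strictMono two_ne_zero).injective ?_)
    simp only [mul_pow, hsq]
    refine (ENNReal.div_mul_cancel' (fun h0 => ?_) fun h => absurd h hwω.ne).symm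
    by_contra hne
    exact hdω.ne (by rw [h0, ENNReal.div_zero hne])
  have hHölder := ENNReal.lintegral_mul_le_Lp_mul_Lq μ Real.HolderConjugate.two_two
    (hd.pow_const (1 / 2 : ℝ)) (hw.pow_const (1 / 2 : ℝ))
  simp only [Pi.mul_apply, ENNReal.rpow_two, hsq, ← lintegral_congr_ae hfactor] at hHölder
  calc (∫⁻ ω, s ω ∂μ) ^ 2
      ≤ ((∫⁻ ω, s ω ^ 2 / w ω ∂μ) ^ (1 / 2 : ℝ) * (∫⁻ ω, w ω ∂μ) ^ (1 / 2 : ℝ)) ^ 2 := by gcongr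
    _ = (∫⁻ ω, s ω ^ 2 / w ω ∂μ) * ∫⁻ ω, w ω ∂μ := by simp only [mul_pow, hsq]

/-- Taking the quotient avoids the junk value `0 * ∞ = 0` on the right of the product form. -/
theorem sq_lintegral_div_lintegral_le {s w : Ω → ℝ≥0∞} (hs : AEMeasurable s μ)
    (hw : AEMeasurable w μ) :
    (∫⁻ ω, s ω ∂μ) ^ 2 / ∫⁻ ω, w ω ∂μ ≤ ∫⁻ ω, s ω ^ 2 / w ω ∂μ := by
  by_cases hdiv : ∫⁻ ω, s ω ^ 2 / w ω ∂μ = ∞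
  · exact hdiv ▸ le_top
  by_cases hwtop : ∫⁻ ω, w ω ∂μ = ∞
  · simp only [hwtop, ENNReal.div_top, zero_le]
  exact ENNReal.div_le_of_le_mul (sq_lintegral_le_lintegral_sq_div_mul hs hw hdiv hwtop)

theorem sq_tsum_div_tsum_le (s w : ι → ℝ≥0∞) :
    (∑' i, s i) ^ 2 / ∑' i, w i ≤ ∑' i, s i ^ 2 / w i := by
  let _ : MeasurableSpace ι := ⊤
  simpa only [lintegral_count] using sq_lintegral_div_lintegral_le (μ := .count)
    (measurable_from_top (f := s)).aemeasurable (measurable_from_top (f := w)).aemeasurable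

theorem sq_tsum_mul_lintegral_div_le (c : ι → ℝ≥0∞) {s w : ι → Ω → ℝ≥0∞}
    (hs : ∀ i, AEMeasurable (s i) μ) (hw : ∀ i, AEMeasurable (w i) μ) :
    (∑' i, c i * ∫⁻ ω, s i ω ∂μ) ^ 2 / ∑' i, ∫⁻ ω, w i ω ∂μ ≤
      ∑' i, c i ^ 2 * ∫⁻ ω, s i ω ^ 2 / w i ω ∂μ := by
  refine (sq_tsum_div_tsum_le _ _).trans (ENNReal.tsum_le_tsum fun i => ?_)
  rw [mul_pow, mul_div_assoc]
  gcongr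
  exact sq_lintegral_div_lintegral_le (hs i) (hw i)

end CauchySchwarz

namespace BanditModel

variable {Ω Θ Ξ 𝒜 𝒴 : Type*} [MeasurableSpace Ω] [MeasurableSpace Θ] [MeasurableSpace Ξ]
  [MeasurableSpace 𝒜] [MeasurableSpace 𝒴] {P : Measure Ω} {M : BanditModel Ω Θ Ξ 𝒜 𝒴 P}
  {A : ℕ → Ω → 𝒜} {Ab : Ω → 𝒜}

theorem measurable_obs {t : ℕ} (hA : Measurable (A t)) : Measurable (M.obs A t) :=
  (M.measurable_Y t).comp (measurable_id.prodMk hA)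

theorem measurable_history {t : ℕ} (hA : ∀ i < t, Measurable (A i)) :
    Measurable (M.history A t) :=
  measurable_pi_lambda _ fun i => (hA i i.2).prodMk (measurable_obs (hA i i.2))

theorem IsPolicyDriven.measurable_action (hA : M.IsPolicyDriven A) (t : ℕ) : Measurable (A t) := by
  obtain ⟨π, hπ, hAπ⟩ := hA
  induction t using Nat.strong_induction_on with
  | _ t ih =>
    rw [show A t = fun ω => π t (M.history A t ω, M.ξ ω) from funext (hAπ t)]
    exact (hπ t).comp ((measurable_history ih).prodMk M.measurable_ξ)

theorem integral_shortfall [IsFiniteMeasure P] {t : ℕ} (hA : ∀ i < t, Measurable (A i)) :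
    ∫ ω, M.shortfall A Ab t ω ∂P = ∫ ω, (M.benchReward Ab ω - M.reward A t ω) ∂P :=
  integral_condExp (measurable_history hA).comap_le

theorem aemeasurable_enorm_shortfall (t : ℕ) :
    AEMeasurable (fun ω => ‖M.shortfall A Ab t ω‖ₑ) P :=
  integrable_condExp.aestronglyMeasurable.enorm

variable [StandardBorelSpace 𝒜] [Nonempty 𝒜] [StandardBorelSpace 𝒴] [Nonempty 𝒴]
  [StandardBorelSpace Ξ] [Nonempty Ξ] [IsProbabilityMeasure P]

theorem aemeasurable_infoGain (hA : ∀ t, Measurable (A t)) (hAb : Measurable Ab) (t : ℕ) :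
    AEMeasurable (M.infoGain A Ab t) P :=
  aemeasurable_condMutualInfo_condDistrib (measurable_history fun i _ => hA i)
    (hAb.prodMk ((measurable_obs (hA t)).prodMk M.measurable_ξ)) (by fun_prop) (by fun_prop)
    (by fun_prop)

theorem lintegral_infoGain_add_condEntropy_history_succ_le (hA : ∀ t, Measurable (A t))
    (hAb : Measurable Ab) (t : ℕ) :
    ∫⁻ ω, M.infoGain A Ab t ω ∂P +
        condEntropy Ab (fun ω => (M.history A (t + 1) ω, M.ξ ω)) P ≤
      condEntropy Ab (fun ω => (M.history A t ω, M.ξ ω)) P := by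
  have hhist (n : ℕ) : Measurable (M.history A n) := measurable_history fun i _ => hA i
  have hchain : condEntropy Ab (fun ω => (M.history A t ω, M.ξ ω)) P =
      ∫⁻ ω, M.infoGain A Ab t ω ∂P +
        condEntropy Ab (fun ω => (M.history A t ω, M.ξ ω, M.obs A t ω)) P :=
    condEntropy_eq_lintegral_condMutualInfo_add (hhist t)
      (hAb.prodMk ((measurable_obs (hA t)).prodMk M.measurable_ξ)) measurable_fst
      (measurable_fst.comp measurable_snd) (measurable_snd.comp measurable_snd)
  rw [hchain]
  gcongr
  -- The next history records `A_t` besides `Y_{t,A_t}`, which can only lower the entropy further.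
  let forget : (Fin (t + 1) → 𝒜 × 𝒴) × Ξ → (Fin t → 𝒜 × 𝒴) × Ξ × 𝒴 :=
    fun q => (fun i => q.1 i.castSucc, q.2, (q.1 (Fin.last t)).2)
  exact condEntropy_le_condEntropy_comp (g := forget) hAb ((hhist (t + 1)).prodMk M.measurable_ξ)
    (by fun_prop)

theorem sum_lintegral_infoGain_add_condEntropy_history_le (hA : ∀ t, Measurable (A t))
    (hAb : Measurable Ab) (n : ℕ) :
    ∑ t ∈ Finset.range n, ∫⁻ ω, M.infoGain A Ab t ω ∂P +
      condEntropy Ab (fun ω => (M.history A n ω, M.ξ ω)) P ≤ condEntropy Ab M.ξ P := by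
  induction n with
  | zero =>
    rw [Finset.sum_range_zero, zero_add]
    exact condEntropy_le_condEntropy_comp (g := Prod.snd) hAb
      ((measurable_history fun i _ => hA i).prodMk M.measurable_ξ) measurable_snd
  | succ n ih =>
    rw [Finset.sum_range_succ, add_assoc]
    refine le_trans ?_ ih
    gcongr
    exact lintegral_infoGain_add_condEntropy_history_succ_le hA hAb n

theorem tsum_lintegral_infoGain_le_condEntropy (hA : ∀ t, Measurable (A t))
    (hAb : Measurable Ab) : ∑' t, ∫⁻ ω, M.infoGain A Ab t ω ∂P ≤ condEntropy Ab M.ξ P := by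
  rw [ENNReal.tsum_eq_iSup_nat]
  exact iSup_le fun n =>
    le_self_add.trans (sum_lintegral_infoGain_add_condEntropy_history_le hA hAb n)

theorem infoRatio_eq_mul_tsum_enorm (α : ℝ) :
    M.infoRatio α A Ab = ENNReal.ofReal (1 - α ^ 2) *
      ∑' t : ℕ, (‖α‖ₑ ^ t) ^ 2 * ∫⁻ ω, ‖M.shortfall A Ab t ω‖ₑ ^ 2 / M.infoGain A Ab t ω ∂P := by
  have hsq (x : ℝ) : ENNReal.ofReal (x ^ 2) = ‖x‖ₑ ^ 2 := by
    rw [← enorm_pow, Real.enorm_of_nonneg (sq_nonneg x)]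
  simp only [infoRatio, mul_comm 2, pow_mul, hsq, enorm_pow]

theorem sq_tsum_mul_lintegral_shortfall_div_condEntropy_le (hA : ∀ t, Measurable (A t))
    (hAb : Measurable Ab) {α : ℝ} (hα : |α| < 1) :
    (∑' t : ℕ, ‖α‖ₑ ^ t * ∫⁻ ω, ‖M.shortfall A Ab t ω‖ₑ ∂P) ^ 2 / condEntropy Ab M.ξ P ≤
      M.infoRatio α A Ab / ENNReal.ofReal (1 - α ^ 2) := by
  have hpos : 0 < 1 - α ^ 2 := sub_pos.2 ((sq_lt_one_iff_abs_lt_one α).2 hα)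
  rw [infoRatio_eq_mul_tsum_enorm, mul_comm (ENNReal.ofReal _),
    ENNReal.mul_div_cancel_right (ENNReal.ofReal_pos.2 hpos).ne' ENNReal.ofReal_ne_top]
  calc (∑' t : ℕ, ‖α‖ₑ ^ t * ∫⁻ ω, ‖M.shortfall A Ab t ω‖ₑ ∂P) ^ 2 / condEntropy Ab M.ξ P
      ≤ (∑' t : ℕ, ‖α‖ₑ ^ t * ∫⁻ ω, ‖M.shortfall A Ab t ω‖ₑ ∂P) ^ 2 /
          ∑' t, ∫⁻ ω, M.infoGain A Ab t ω ∂P := by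
        gcongr
        exact tsum_lintegral_infoGain_le_condEntropy hA hAb
    _ ≤ _ := sq_tsum_mul_lintegral_div_le _ aemeasurable_enorm_shortfall
        (aemeasurable_infoGain hA hAb)

theorem tsum_mul_lintegral_shortfall_le (hA : ∀ t, Measurable (A t)) (hAb : Measurable Ab)
    {α : ℝ} (hα : |α| < 1)
    (hprod : ¬(M.infoRatio α A Ab = 0 ∧ condEntropy Ab M.ξ P = ∞) ∧
      ¬(M.infoRatio α A Ab = ∞ ∧ condEntropy Ab M.ξ P = 0)) :
    ∑' t : ℕ, ‖α‖ₑ ^ t * ∫⁻ ω, ‖M.shortfall A Ab t ω‖ₑ ∂P ≤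
      (M.infoRatio α A Ab * condEntropy Ab M.ξ P / ENNReal.ofReal (1 - α ^ 2)) ^ (1 / 2 : ℝ) := by
  have hpos : ENNReal.ofReal (1 - α ^ 2) ≠ 0 :=
    (ENNReal.ofReal_pos.2 (sub_pos.2 ((sq_lt_one_iff_abs_lt_one α).2 hα))).ne'
  have hbound := sq_tsum_mul_lintegral_shortfall_div_condEntropy_le (M := M) hA hAb hα
  rw [ENNReal.div_le_iff_le_mul, ← ENNReal.mul_div_right_comm] at hbound
  · rwa [one_div, ENNReal.le_rpow_inv_iff two_pos, ENNReal.rpow_two]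
  · simp only [ne_eq, ENNReal.div_eq_top]
    have := ENNReal.ofReal_ne_top (r := 1 - α ^ 2)
    tauto
  · simp only [ne_eq, ENNReal.div_eq_zero_iff]
    have := ENNReal.ofReal_ne_top (r := 1 - α ^ 2)
    tauto

end BanditModel

section DiscountedSeries

variable {Ω : Type*} [MeasurableSpace Ω] {P : Measure Ω} {α : ℝ} {U B : Ω → ℝ} {V : ℕ → Ω → ℝ}

theorem summable_discounted_integral_norm_sub (hα : |α| < 1) (hU : Integrable U P)
    (hV : ∀ t, Integrable (V t) P) (hsum : Summable fun t : ℕ => α ^ t * ∫ ω, |V t ω| ∂P) :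
    Summable fun t : ℕ => ∫ ω, ‖α ^ t * (U ω - V t ω)‖ ∂P := by
  have hgeo : Summable fun t : ℕ => |α| ^ t := summable_geometric_of_lt_one (abs_nonneg α) hα
  have hsum' : Summable fun t : ℕ => |α| ^ t * ∫ ω, |V t ω| ∂P :=
    hsum.abs.congr fun t => by
      rw [abs_mul, abs_pow, abs_of_nonneg (integral_nonneg fun ω => abs_nonneg (V t ω))]
  refine .of_nonneg_of_le (fun t => integral_nonneg fun ω => norm_nonneg _) (fun t => ?_)
    ((hgeo.mul_right (∫ ω, |U ω| ∂P)).add hsum')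
  calc ∫ ω, ‖α ^ t * (U ω - V t ω)‖ ∂P
      = |α| ^ t * ∫ ω, |U ω - V t ω| ∂P := by
        simp only [norm_mul, norm_pow, Real.norm_eq_abs, integral_const_mul]
    _ ≤ |α| ^ t * ∫ ω, (|U ω| + |V t ω|) ∂P := by
        gcongr
        exacts [(hU.sub (hV t)).abs, hU.abs.add (hV t).abs, fun ω => abs_sub _ _]
    _ = |α| ^ t * ∫ ω, |U ω| ∂P + |α| ^ t * ∫ ω, |V t ω| ∂P := by
        rw [integral_add hU.abs (hV t).abs, mul_add]

theorem integral_tsum_discounted_sub (hα : |α| < 1) (hU : Integrable U P) (hB : Integrable B P)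
    (hV : ∀ t, Integrable (V t) P) (hsum : Summable fun t : ℕ => α ^ t * ∫ ω, |V t ω| ∂P) :
    ∫ ω, ∑' t : ℕ, α ^ t * (U ω - V t ω) ∂P =
      (∫ ω, (U ω - B ω) ∂P) / (1 - α) + ∑' t : ℕ, α ^ t * ∫ ω, (B ω - V t ω) ∂P := by
  have hterm (t : ℕ) : ∫ ω, α ^ t * (U ω - V t ω) ∂P =
      α ^ t * ∫ ω, (U ω - B ω) ∂P + α ^ t * ∫ ω, (B ω - V t ω) ∂P := by
    rw [integral_const_mul, integral_sub hU (hV t), integral_sub hU hB, integral_sub hB (hV t)]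
    ring
  have hgeo : Summable fun t : ℕ => α ^ t := summable_geometric_of_abs_lt_one hα
  have hBsum : Summable fun t : ℕ => α ^ t * ∫ ω, (B ω - V t ω) ∂P :=
    .of_norm_bounded (summable_discounted_integral_norm_sub hα hB hV hsum) fun t => by
      rw [← integral_const_mul]
      exact norm_integral_le_integral_norm _
  rw [← integral_tsum_of_summable_integral_norm (F := fun t ω => α ^ t * (U ω - V t ω))
    (fun t => (hU.sub (hV t)).const_mul _)
    (summable_discounted_integral_norm_sub hα hU hV hsum)]
  simp only [hterm]
  rw [(hgeo.mul_right _).tsum_add hBsum, tsum_mul_right, tsum_geometric_of_abs_lt_one hα,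
    div_eq_inv_mul]

theorem enorm_tsum_mul_integral_le (α : ℝ) (V : ℕ → Ω → ℝ) :
    ‖∑' t : ℕ, α ^ t * ∫ ω, V t ω ∂P‖ₑ ≤ ∑' t : ℕ, ‖α‖ₑ ^ t * ∫⁻ ω, ‖V t ω‖ₑ ∂P := by
  refine enorm_tsum_le_tsum_enorm.trans (ENNReal.tsum_le_tsum fun t => ?_)
  rw [enorm_mul, enorm_pow]
  gcongr
  exact enorm_integral_le_lintegral_enorm _

theorem coe_le_coe_enorm (x : ℝ) : (x : EReal) ≤ (‖x‖ₑ : ℝ≥0∞) := by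
  rw [Real.enorm_eq_ofReal_abs, EReal.coe_ennreal_ofReal, max_eq_left (abs_nonneg x)]
  exact EReal.coe_le_coe (le_abs_self x)

end DiscountedSeries

theorem mainTheorem1_general {Ω Θ Ξ 𝒜 𝒴 : Type*} [MeasurableSpace Ω] [MeasurableSpace Θ]
    [MeasurableSpace Ξ] [StandardBorelSpace Ξ] [Nonempty Ξ]
    [MeasurableSpace 𝒜] [StandardBorelSpace 𝒜] [Nonempty 𝒜]
    [MeasurableSpace 𝒴] [StandardBorelSpace 𝒴] [Nonempty 𝒴]
    (P : Measure Ω) [IsProbabilityMeasure P] (M : BanditModel Ω Θ Ξ 𝒜 𝒴 P)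
    (α : ℝ) (hα : |α| < 1) (A : ℕ → Ω → 𝒜) (hA : ∀ t, Measurable (A t))
    (Ab : Ω → 𝒜) (hAb : Measurable Ab) (U : Ω → ℝ) (hU : Integrable U P)
    (hbench : Integrable (M.benchReward Ab) P) (hrew : ∀ t, Integrable (M.reward A t) P)
    (hsum : Summable fun t : ℕ => α ^ t * ∫ ω, |M.reward A t ω| ∂P)
    (hprod : ¬(M.infoRatio α A Ab = 0 ∧ condEntropy Ab M.ξ P = ∞) ∧
      ¬(M.infoRatio α A Ab = ∞ ∧ condEntropy Ab M.ξ P = 0)) :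
    ((∫ ω, ∑' t : ℕ, α ^ t * (U ω - M.reward A t ω) ∂P : ℝ) : EReal) ≤
      (((∫ ω, (U ω - M.benchReward Ab ω) ∂P) / (1 - α) : ℝ) : EReal) +
        (((M.infoRatio α A Ab * condEntropy Ab M.ξ P / ENNReal.ofReal (1 - α ^ 2)) ^ (1 / 2 : ℝ) :
          ℝ≥0∞) : EReal) := by
  have hshortfall : ‖∑' t : ℕ, α ^ t * ∫ ω, (M.benchReward Ab ω - M.reward A t ω) ∂P‖ₑ ≤
      ∑' t : ℕ, ‖α‖ₑ ^ t * ∫⁻ ω, ‖M.shortfall A Ab t ω‖ₑ ∂P := by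
    simp only [← BanditModel.integral_shortfall fun i _ => hA i]
    exact enorm_tsum_mul_integral_le α (M.shortfall A Ab)
  rw [integral_tsum_discounted_sub hα hU hbench hrew hsum, EReal.coe_add]
  gcongr
  refine (coe_le_coe_enorm _).trans (EReal.coe_ennreal_le_coe_ennreal_iff.2 ?_)
  exact hshortfall.trans (BanditModel.tsum_mul_lintegral_shortfall_le hA hAb hα hprod)

theorem mainTheorem1 {Ω Θ Ξ 𝒜 𝒴 : Type*} [MeasurableSpace Ω] [MeasurableSpace Θ]
    [MeasurableSpace Ξ] [StandardBorelSpace Ξ] [Nonempty Ξ]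
    [MeasurableSpace 𝒜] [StandardBorelSpace 𝒜] [Nonempty 𝒜]
    [MeasurableSpace 𝒴] [StandardBorelSpace 𝒴] [Nonempty 𝒴]
    (P : Measure Ω) [IsProbabilityMeasure P] (M : BanditModel Ω Θ Ξ 𝒜 𝒴 P)
    (α : ℝ) (hα0 : 0 ≤ α) (hα1 : α < 1)
    (A : ℕ → Ω → 𝒜) (hA : M.IsPolicyDriven A)
    (Ab : Ω → 𝒜) (hAb : Measurable Ab)
    -- the optimal reward is well defined and integrable
    (hmean : ∀ᵐ ω ∂P, ∀ a, Integrable (fun y : 𝒜 → 𝒴 => M.R (y a)) (M.κ (M.θ ω)))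
    (hbdd : ∀ᵐ ω ∂P, BddAbove (Set.range fun a => M.meanReward (M.θ ω) a))
    (hopt : Integrable M.optReward P)
    -- the rewards are integrable and the discounted series converges absolutely in `L¹`
    (hbench : Integrable (M.benchReward Ab) P)
    (hrew : ∀ t, Integrable (M.reward A t) P)
    (hsum : Summable fun t : ℕ => α ^ t * ∫ ω, |M.reward A t ω| ∂P)
    -- the product `Γ · H` is not of the undefined form `0 · ∞`
    (hprod : ¬ (M.infoRatio α A Ab = 0 ∧ condEntropy Ab M.ξ P = ∞) ∧
      ¬ (M.infoRatio α A Ab = ∞ ∧ condEntropy Ab M.ξ P = 0)) :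
    ((∫ ω, ∑' t : ℕ, α ^ t * (M.optReward ω - M.reward A t ω) ∂P : ℝ) : EReal) ≤
      (((∫ ω, (M.optReward ω - M.benchReward Ab ω) ∂P) / (1 - α) : ℝ) : EReal) +
        (((M.infoRatio α A Ab * condEntropy Ab M.ξ P / ENNReal.ofReal (1 - α ^ 2)) ^ (1 / 2 : ℝ) :
          ℝ≥0∞) : EReal) :=
  mainTheorem1_general P M α (abs_lt.2 ⟨by linarith, hα1⟩) A hA.measurable_action Ab hAb
    M.optReward hopt hbench hrew hsum hprod
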